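/- Theorem (formula for $\nabla'_k$). Let $V=\bigoplus_{n\in\mathbf Z}V_n$ be a quasi-vertex operator algebra over $\mathbf C$: a $\mathbf Z$-graded vertex algebra with $\dim V_n<\infty$ for all $n$ and $V_n=0$ for $n\ll 0$, with operators $L(-1),L(0),L(1)$ satisfying $[L(m),L(n)]=(m-n)L(m+n)$, where $L(-1)a=a(-2)\mathbf 1$, $L(0)$ is multiplication by $n$ on $V_n$, $(L(-1)a)(n)=-n\,a(n-1)=[L(-1),a(n)]$, and $[L(1),a(n)]=(L(1)a)(n)+(2k-n-2)a(n+1)$ for $a\in V_k$. Put $F_NV=\bigoplus_{n\le N}V_n$. For $k\in\mathbf Z$ let $M_k(V)$ be the space of functions $f\colon\mathcal H\to F_NV$ on the upper half-plane (for some $N$) that are holomorphic, have an expansion $f=\sum_{n\ge0}a_nq^n$ with $a_n\in F_NV$, $q=e^{2\pi i\tau}$, and satisfy $$f(\gamma\tau)=(c\tau+d)^k\,e^{-c(c\tau+d)L(1)}(c\tau+d)^{-2L(0)}f(\tau)\qquad\text{for all }\gamma=\begin{pmatrix}a&b\\c&d\end{pmatrix}\in SL_2(\mathbf Z).$$ Let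 $M=\bigoplus_k M_k$ be the algebra of holomorphic modular forms on $SL_2(\mathbf Z)$, let $E_2,E_4$ be the Eisenstein series with constant term $1$, let $\theta=q\frac{d}{dq}$, and let $D\colon M\to M$ be the Serre derivative, $Df=D_rf=\theta f-\frac{r}{12}E_2f$ for $f\in M_r$. Let $V^{(2)}$ be $V$ with doubled grading, so that the weight $k$ part of $M\otimes V^{(2)}$ is $(M\otimes V^{(2)})_k=\bigoplus_{r+2n=k}M_r\otimes V_n$. Put $\mathfrak c=-\frac{2\pi i}{12}$, $$P(f\otimes v)=\sum_{n\ge0}\frac1{n!}(\mathfrak cE_2)^nf\,L(1)^nv\quad(f\in M,\ v\in V),\qquad \nabla_kF=\frac{dF}{d\tau}-\frac{2\pi i k}{12}E_2F+L(-1)F .$$ Then for every $k$ the map $P$ restricts to a linear isomorphism $(M\otimes V^{(2)})_k\to M_k(V)$, and $\nabla_k$ maps $M_k(V)$ into $M_{k+2}(V)$. Moreover there is exactly one linear operator $\nabla'$ on $M\otimes V^{(2)}$ which for every $k$ maps $(M\otimes V^{(2)})_k$ into $(M\otimes V^{(2)})_{k+2}$ and satisfies $P(\nabla' x)=\nabla_k(Px)$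 for all $x\in(M\otimes V^{(2)})_k$ (its restriction to weight $k$ is $\nabla'_k$), and it is $$\nabla'=2\pi i\Bigl(D\otimes\mathrm{id}-\mathfrak c\,\tfrac{E_4}{12}\otimes L(1)\Bigr)+\mathrm{id}\otimes L(-1),$$ where $E_4$ denotes multiplication by $E_4$. -/

import Mathlib

open UpperHalfPlane hiding I
open Complex
open scoped MatrixGroups TensorProduct DirectSum Manifold

noncomputable section

/-! ## Quasi-vertex operator algebras -/

/-- A quasi-vertex operator algebra over `ℂ` on the Fock space `V`. The fields `Y a` are
`VertexOperator`s, so that for each `b` one has `a(n) b = 0` for `n` large; the mode `a(n)` is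
`VertexOperator.ncoeff (Y a) n`. The representation of `sl₂` is recorded by the images `L(-1)`,
`L(0)`, `L(1)` of a basis, with `[L(m), L(n)] = (m - n) L(m + n)` for `m, n ∈ {-1, 0, 1}`. -/
structure QuasiVOA (V : Type*) [AddCommGroup V] [Module ℂ V] where
  /-- The state-field correspondence. -/
  Y : V →ₗ[ℂ] VertexOperator ℂ V
  /-- The vacuum. -/
  vac : V
  vac_ne_zero : vac ≠ 0
  mode_vac : ∀ (a : V) (n : ℤ), 0 ≤ n → VertexOperator.ncoeff (Y a) n vac = 0
  mode_neg_one_vac : ∀ a : V, VertexOperator.ncoeff (Y a) (-1) vac = a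
  /-- The Jacobi identity in components (all three sums have finitely many nonzero terms). -/
  jacobi : ∀ (a b c : V) (r s t : ℤ),
    ∑ᶠ i : ℕ, ((Ring.choose r i : ℤ) : ℂ) •
        VertexOperator.ncoeff (Y (VertexOperator.ncoeff (Y a) (t + i) b)) (r + s - i) c =
      ∑ᶠ i : ℕ, ((-1) ^ i * ((Ring.choose t i : ℤ) : ℂ)) •
        (VertexOperator.ncoeff (Y a) (r + t - i) (VertexOperator.ncoeff (Y b) (s + i) c) -
          (-1 : ℂ) ^ t •
            VertexOperator.ncoeff (Y b) (s + t - i) (VertexOperator.ncoeff (Y a) (r + i) c))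
  /-- `deg n` is the space `V_n` of states of conformal degree `n`. -/
  deg : ℤ → Submodule ℂ V
  isInternal : DirectSum.IsInternal deg
  finite_deg : ∀ n, Module.Finite ℂ (deg n)
  deg_eq_bot : ∃ n₀ : ℤ, ∀ n < n₀, deg n = ⊥
  mode_mem : ∀ (k l n : ℤ), ∀ a ∈ deg k, ∀ b ∈ deg l,
    VertexOperator.ncoeff (Y a) n b ∈ deg (k + l - n - 1)
  /-- The raising operator `L(-1)`. -/
  Lneg : Module.End ℂ V
  /-- The Euler operator `L(0)`. -/
  Lzero : Module.End ℂ V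
  /-- The lowering operator `L(1)`. -/
  Lone : Module.End ℂ V
  Lneg_apply : ∀ a, Lneg a = VertexOperator.ncoeff (Y a) (-2) vac
  Lzero_apply : ∀ (n : ℤ), ∀ a ∈ deg n, Lzero a = (n : ℂ) • a
  bracket_zero_neg : ⁅Lzero, Lneg⁆ = Lneg
  bracket_one_zero : ⁅Lone, Lzero⁆ = Lone
  bracket_one_neg : ⁅Lone, Lneg⁆ = (2 : ℂ) • Lzero
  /-- Translation covariance. -/
  mode_Lneg : ∀ (a : V) (n : ℤ),
    VertexOperator.ncoeff (Y (Lneg a)) n = (-n : ℂ) • VertexOperator.ncoeff (Y a) (n - 1)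
  bracket_Lneg_mode : ∀ (a : V) (n : ℤ),
    ⁅Lneg, VertexOperator.ncoeff (Y a) n⁆ = (-n : ℂ) • VertexOperator.ncoeff (Y a) (n - 1)
  bracket_Lone_mode : ∀ (k n : ℤ), ∀ a ∈ deg k,
    ⁅Lone, VertexOperator.ncoeff (Y a) n⁆ = VertexOperator.ncoeff (Y (Lone a)) n +
      (2 * k - n - 2 : ℂ) • VertexOperator.ncoeff (Y a) (n + 1)

namespace QuasiVOA

variable {V : Type*} [AddCommGroup V] [Module ℂ V] (A : QuasiVOA V)

/-- The decomposition `V ≃ ⨁ n, V_n`. -/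
def decomp : V ≃ₗ[ℂ] ⨁ n, A.deg n :=
  (LinearEquiv.ofBijective (DirectSum.coeLinearMap A.deg) A.isInternal).symm

/-- The truncation `F_N V = ⨁_{n ≤ N} V_n`. -/
def filt (N : ℤ) : Submodule ℂ V := ⨆ n : {n : ℤ // n ≤ N}, A.deg n

/-- The operator `t ^ L(0)`, which multiplies `V_n` by `t ^ n`. -/
def powLzero (t : ℂ) : V →ₗ[ℂ] V :=
  DirectSum.toModule ℂ ℤ V (fun n => t ^ n • (A.deg n).subtype) ∘ₗ A.decomp.toLinearMap

theorem mem_deg_of_Lzero {m : ℤ} {w : V} (h : A.Lzero w = (m : ℂ) • w) : w ∈ A.deg m := by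
  classical
  have key : ∀ x : ⨁ n, A.deg n, A.Lzero (DirectSum.coeLinearMap A.deg x) =
      DirectSum.coeLinearMap A.deg
        (DirectSum.lmap (fun n : ℤ => (n : ℂ) • (LinearMap.id : A.deg n →ₗ[ℂ] A.deg n)) x) := by
    intro x
    induction x using DirectSum.induction_on with
    | zero => simp
    | of i y =>
      have := A.Lzero_apply i y y.2
      rw [← DirectSum.lof_eq_of ℂ, DirectSum.lmap_lof]
      simp [this]
    | add x y hx hy => simp only [map_add, hx, hy]
  obtain ⟨x, rfl⟩ := A.isInternal.2 w
  change A.Lzero (DirectSum.coeLinearMap A.deg x) =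
    (m : ℂ) • (DirectSum.coeLinearMap A.deg x) at h
  rw [key, ← map_smul] at h
  have h' := A.isInternal.1 h
  have hx : x = DirectSum.lof ℂ ℤ (fun n => A.deg n) m (x m) := by
    refine DFinsupp.ext fun i => ?_
    by_cases hi : i = m
    · subst hi; simp [DirectSum.lof_eq_of]
    · have h1 : ((i : ℂ) • x i) = (m : ℂ) • x i := by
        have h0 := congrArg (fun z : ⨁ n, A.deg n => z i) h'
        simp only [DirectSum.lmap_apply, LinearMap.smul_apply, LinearMap.id_apply] at h0
        exact h0
      have h2 : ((i : ℂ) - m) • x i = 0 := by rw [sub_smul, h1, sub_self]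
      have h3 : ((i : ℂ) - m) ≠ 0 := sub_ne_zero.2 (by exact_mod_cast hi)
      have h4 : x i = 0 := (smul_eq_zero.1 h2).resolve_left h3
      rw [h4, DirectSum.lof_eq_of, DirectSum.of_eq_of_ne _ _ _ hi]
  change DirectSum.coeLinearMap A.deg x ∈ A.deg m
  rw [hx]
  simp

theorem Lone_mem {k : ℤ} {v : V} (hv : v ∈ A.deg k) : A.Lone v ∈ A.deg (k - 1) := by
  apply A.mem_deg_of_Lzero
  have h := LinearMap.congr_fun A.bracket_one_zero v
  rw [Ring.lie_def, LinearMap.sub_apply, Module.End.mul_apply, Module.End.mul_apply,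
    A.Lzero_apply k v hv, map_smul] at h
  push_cast
  rw [sub_smul, one_smul]
  exact (sub_eq_of_eq_add (eq_add_of_sub_eq' h)).symm

theorem Lone_pow_mem {k : ℤ} {v : V} (hv : v ∈ A.deg k) (n : ℕ) :
    (A.Lone ^ n) v ∈ A.deg (k - n) := by
  induction n with
  | zero => simpa using hv
  | succ n ih =>
    rw [pow_succ', Module.End.mul_apply]
    have := A.Lone_mem ih
    rwa [show k - ((n + 1 : ℕ) : ℤ) = k - n - 1 by push_cast; ring]

theorem finite_support_Lone_pow (v : V) : (Function.support fun n : ℕ => (A.Lone ^ n) v).Finite := by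
  have hv : v ∈ ⨆ n, A.deg n := by
    rw [A.isInternal.submodule_iSup_eq_top]; trivial
  induction hv using Submodule.iSup_induction' with
  | mem k v hv =>
    obtain ⟨n₀, h₀⟩ := A.deg_eq_bot
    refine (Set.finite_Iic (k - n₀).toNat).subset fun n hn => ?_
    by_contra hlt
    have h := A.Lone_pow_mem hv n
    rw [h₀ _ (by simp only [Set.mem_Iic, not_le] at hlt; omega), Submodule.mem_bot] at h
    exact hn h
  | zero => simp
  | add x y _ _ hx hy =>
    refine (hx.union hy).subset fun n hn => ?_
    by_contra hc
    simp only [Set.mem_union, Function.mem_support, not_or, not_not] at hc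
    exact hn (by simp [hc.1, hc.2])

/-- The operator `exp (t L(1)) = ∑ n, t ^ n / n! • L(1) ^ n`; it is defined because `L(1)` is
locally nilpotent. -/
def expLone (t : ℂ) : V →ₗ[ℂ] V where
  toFun v := ∑ᶠ n : ℕ, (t ^ n / n.factorial) • (A.Lone ^ n) v
  map_add' v w := by
    rw [← finsum_add_distrib]
    · simp
    · exact (A.finite_support_Lone_pow v).subset fun n hn h => hn (by simp only [h, smul_zero])
    · exact (A.finite_support_Lone_pow w).subset fun n hn h => hn (by simp only [h, smul_zero])
  map_smul' c v := by
    simp only [map_smul, RingHom.id_apply]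
    rw [smul_finsum]
    exact finsum_congr fun n => smul_comm _ _ _

end QuasiVOA

/-! ## Scalar modular forms of level one and the Serre derivative -/

/-- The graded algebra `M = ⨁ k, M_k` of holomorphic modular forms on `SL(2, ℤ)`. -/
abbrev LevelOneForms : Type := ⨁ k : ℤ, ModularForm 𝒮ℒ k

theorem isBoundedAtImInfty_normalizedDeriv {f : ℍ → ℂ} (hf : MDiff f)
    (hb : IsBoundedAtImInfty f) : IsBoundedAtImInfty (Derivative.normalizedDerivOfComplex f) := by
  rw [UpperHalfPlane.isBoundedAtImInfty_iff] at hb ⊢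
  obtain ⟨B, R, h⟩ := hb
  refine ⟨‖(2 * Real.pi * I : ℂ)⁻¹‖ * B, max R 0 + 2, fun z hz => ?_⟩
  have hz' : max R 0 + 2 ≤ (z : ℂ).im := hz
  have him : ∀ w ∈ Metric.closedBall (z : ℂ) 1, max R 0 < w.im := by
    intro w hw
    have h1 : |(w - z).im| ≤ 1 := (Complex.abs_im_le_norm _).trans (by simpa [dist_eq_norm] using hw)
    rw [Complex.sub_im, abs_le] at h1
    linarith [h1.1]
  have hd : DifferentiableOn ℂ (f ∘ ofComplex) (Metric.closedBall (z : ℂ) 1) :=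
    (UpperHalfPlane.mdifferentiable_iff.1 hf).mono fun w hw =>
      lt_of_le_of_lt (le_max_right R 0) (him w hw)
  have hc := Complex.norm_deriv_le_of_forall_mem_sphere_norm_le (C := B) one_pos
    (hd.diffContOnCl_ball subset_rfl) fun w hw => by
      have hw' := him w (Metric.sphere_subset_closedBall hw)
      have hpos : 0 < w.im := lt_of_le_of_lt (le_max_right R 0) hw'
      rw [Function.comp_apply, ofComplex_apply_of_im_pos hpos]
      exact h ⟨w, hpos⟩ ((le_max_left R 0).trans hw'.le)
  rw [Derivative.normalizedDerivOfComplex, norm_mul]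
  exact mul_le_mul_of_nonneg_left (by simpa using hc) (norm_nonneg _)

theorem isBoundedAtImInfty_serreDerivative {f : ℍ → ℂ} (c : ℂ) (hf : MDiff f)
    (hb : IsBoundedAtImInfty f) : IsBoundedAtImInfty (Derivative.serreDerivative c f) := by
  have h1 : IsBoundedAtImInfty (fun _ : ℍ => c * 12⁻¹) :=
    Filter.const_boundedAtFilter _ _
  have h2 := (h1.mul EisensteinSeries.isBoundedAtImInfty_E2).mul hb
  exact (isBoundedAtImInfty_normalizedDeriv hf hb).sub h2

/-- The Serre derivative `D_k f = θ f - (k / 12) E₂ f`, with `θ = (2πi)⁻¹ d/dτ`, as a linear map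
`M_k → M_{k+2}`. -/
def serreDerivLevelOne (k : ℤ) : ModularForm 𝒮ℒ k →ₗ[ℂ] ModularForm 𝒮ℒ (k + 2) where
  toFun f :=
    { toFun := Derivative.serreDerivative k f
      slash_action_eq' := by
        rintro _ ⟨γ, rfl⟩
        exact Derivative.serreDerivative_slash_invariant f.holo'
          (f.slash_action_eq' _ ⟨γ, rfl⟩)
      holo' := Derivative.serreDerivative_mdifferentiable _ f.holo'
      bdd_at_cusps' := fun {c} hc => by
        rw [OnePoint.isBoundedAt_iff_forall_SL2Z hc]
        intro γ _
        have h := Derivative.serreDerivative_slash_invariant (γ := γ) f.holo'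
          (f.slash_action_eq' _ ⟨γ, rfl⟩)
        refine (congrArg IsBoundedAtImInfty h).mpr ?_
        exact isBoundedAtImInfty_serreDerivative _ f.holo' (ModularFormClass.bdd_at_infty f) }
  map_add' f g := by
    ext z
    exact congrFun (Derivative.serreDerivative_add k f g f.holo' g.holo') z
  map_smul' c f := by
    ext z
    exact congrFun (Derivative.serreDerivative_smul k c f f.holo') z

namespace LevelOneForms

/-- The derivation `D` of `M`, equal to the Serre derivative `D_k` on `M_k`. -/
def serreD : LevelOneForms →ₗ[ℂ] LevelOneForms :=
  DirectSum.toModule ℂ ℤ LevelOneForms fun k =>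
    DirectSum.lof ℂ ℤ (fun k : ℤ => ModularForm 𝒮ℒ k) (k + 2) ∘ₗ serreDerivLevelOne k

/-- Multiplication by `E₄` on `M`. -/
def mulE4 : LevelOneForms →ₗ[ℂ] LevelOneForms :=
  LinearMap.mulLeft ℂ (DirectSum.of (fun k : ℤ => ModularForm 𝒮ℒ k) 4 ModularForm.E₄)

/-- The element of `M` viewed as a function on the upper half-plane. -/
def toFun : LevelOneForms →ₗ[ℂ] (ℍ → ℂ) :=
  DirectSum.toModule ℂ ℤ (ℍ → ℂ) fun _ =>
    { toFun := fun f => ⇑f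
      map_add' := fun _ _ => rfl
      map_smul' := fun _ _ => rfl }

end LevelOneForms

/-! ## Modular forms with values in a quasi-vertex operator algebra -/

/-- The constant `𝔠 = -2πi / 12`. -/
def frakC : ℂ := -(2 * Real.pi * I) / 12

/-- The derivative at `τ` of a function with values in a complex vector space `V`: the vector
whose image under every linear functional `φ` is the derivative of `φ ∘ f` (and `0` if there is no
such vector). For `f` with values in a finite-dimensional subspace it is the usual derivative. -/
def vectorDeriv {V : Type*} [AddCommGroup V] [Module ℂ V] (f : ℍ → V) (τ : ℍ) : V :=
  open scoped Classical in
  if h : ∃ w : V, ∀ φ : Module.Dual ℂ V,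
      HasDerivAt (fun z : ℂ => φ (f (ofComplex z))) (φ w) τ
  then h.choose else 0

namespace QuasiVOA

variable {V : Type*} [AddCommGroup V] [Module ℂ V] (A : QuasiVOA V)

/-- The cocycle `K(γ, τ) = exp (-c j(γ, τ) L(1)) j(γ, τ) ^ (-2 L(0))` on `SL(2, ℤ)`, where
`γ = (a b; c d)` and `j(γ, τ) = c τ + d`. -/
def cocycle (γ : SL(2, ℤ)) (τ : ℍ) : V →ₗ[ℂ] V :=
  A.expLone (-((γ 1 0 : ℤ) : ℂ) * denom γ τ) ∘ₗ A.powLzero (denom γ τ ^ (-2 : ℤ))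

/-- The space `M_k(V)` of holomorphic `V`-valued modular forms of weight `k`: the functions
`f : ℍ → F_N V`, for some `N`, which are holomorphic, satisfy
`f (γ τ) = j(γ, τ) ^ k K(γ, τ) f(τ)` for `γ ∈ SL(2, ℤ)`, and have an expansion
`f = ∑_{n ≥ 0} a_n q ^ n`, with `a_n ∈ F_N V`. As `F_N V` has finite dimension, holomorphy and
convergence can be tested on linear functionals. -/
def modularForms (k : ℤ) : Submodule ℂ (ℍ → V) where
  carrier := {f | ∃ N : ℤ,
    (∀ τ, f τ ∈ A.filt N) ∧
    (∀ φ : Module.Dual ℂ V, MDiff (fun τ => φ (f τ))) ∧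
    (∀ (γ : SL(2, ℤ)) (τ : ℍ), f (γ • τ) = denom γ τ ^ k • A.cocycle γ τ (f τ)) ∧
    ∃ a : ℕ → V, (∀ n, a n ∈ A.filt N) ∧ ∀ (φ : Module.Dual ℂ V) (τ : ℍ),
      HasSum (fun n => φ (a n) * cexp (2 * Real.pi * I * τ) ^ n) (φ (f τ))}
  zero_mem' := ⟨0, by simp, fun φ => by simp [mdifferentiable_const], by simp,
    0, by simp, fun φ τ => by simpa using hasSum_zero⟩
  add_mem' := by
    rintro f g ⟨N, h1, h2, h3, a, h4, h5⟩ ⟨N', h1', h2', h3', a', h4', h5'⟩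
    have hmono : ∀ M, M ≤ max N N' → A.filt M ≤ A.filt (max N N') := fun M hM =>
      iSup_le fun n => le_iSup (fun n : {n : ℤ // n ≤ max N N'} => A.deg n) ⟨n, n.2.trans hM⟩
    refine ⟨max N N', fun τ => add_mem (hmono _ (le_max_left _ _) (h1 τ))
      (hmono _ (le_max_right _ _) (h1' τ)), fun φ => ?_, fun γ τ => ?_, a + a', fun n =>
      add_mem (hmono _ (le_max_left _ _) (h4 n)) (hmono _ (le_max_right _ _) (h4' n)),
      fun φ τ => ?_⟩
    · simpa using! (h2 φ).add (h2' φ)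
    · rw [Pi.add_apply, h3, h3', ← smul_add, ← map_add, Pi.add_apply]
    · simpa [add_mul] using (h5 φ τ).add (h5' φ τ)
  smul_mem' := by
    rintro c f ⟨N, h1, h2, h3, a, h4, h5⟩
    refine ⟨N, fun τ => Submodule.smul_mem _ c (h1 τ), fun φ => ?_, fun γ τ => ?_, c • a,
      fun n => Submodule.smul_mem _ c (h4 n), fun φ τ => ?_⟩
    · simpa using! (h2 φ).const_smul c
    · simp only [Pi.smul_apply, h3, map_smul]
      exact smul_comm _ _ _
    · simpa [mul_assoc] using (h5 φ τ).mul_left c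

/-- The modular derivative `∇_k f = df/dτ + L(-1) f - (2πi k / 12) E₂ f`, that is,
`∇_k = 2πi D_k + L(-1)`. -/
def nabla (k : ℤ) (f : ℍ → V) (τ : ℍ) : V :=
  vectorDeriv f τ + A.Lneg (f τ) - (2 * Real.pi * I * k / 12 * EisensteinSeries.E2 τ) • f τ

/-- The map `P = exp (𝔠 E₂ ⊗ L(1))` on `M ⊗ V`, with its values regarded as functions `ℍ → V`:
`P (f ⊗ v) = ∑ n, 1 / n! (𝔠 E₂) ^ n f L(1) ^ n v`. -/
def P : LevelOneForms ⊗[ℂ] V →ₗ[ℂ] (ℍ → V) :=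
  TensorProduct.lift (LinearMap.mk₂ ℂ
    (fun f v τ => LevelOneForms.toFun f τ • A.expLone (frakC * EisensteinSeries.E2 τ) v)
    (fun f g v => by ext τ; simp [add_smul])
    (fun c f v => by ext τ; simp [mul_smul])
    (fun f v w => by ext τ; simp)
    (fun c f v => by ext τ; simp [smul_comm c]))

/-- The weight `k` component `⨁_{r + 2n = k} M_r ⊗ V_n` of `M ⊗ V^{(2)}`, where `V^{(2)}` is `V`
with its grading doubled. -/
def weightPart (k : ℤ) : Submodule ℂ (LevelOneForms ⊗[ℂ] V) :=
  Submodule.span ℂ {t | ∃ (r n : ℤ) (f : ModularForm 𝒮ℒ r) (v : V), r + 2 * n = k ∧ v ∈ A.deg n ∧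
    t = DirectSum.of (fun k : ℤ => ModularForm 𝒮ℒ k) r f ⊗ₜ[ℂ] v}

/-- The operator `2πi (D ⊗ id - 𝔠 (E₄ / 12) ⊗ L(1)) + id ⊗ L(-1)` on `M ⊗ V`. -/
def nablaPrime : Module.End ℂ (LevelOneForms ⊗[ℂ] V) :=
  (2 * Real.pi * I : ℂ) •
      (TensorProduct.map LevelOneForms.serreD LinearMap.id -
        frakC • TensorProduct.map ((1 / 12 : ℂ) • LevelOneForms.mulE4) A.Lone) +
    TensorProduct.map LinearMap.id A.Lneg

end QuasiVOA

end

/-! Write `j` for `denom γ τ`, `c` for `γ 1 0` and `x = 𝔠 E₂`. The failure of `E₂` to be modular is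
normalized so that `x(γτ) = j² x(τ) - c j` (`frakC_mul_E2_smul`). Since `t^L(0)` conjugates `exp (y
L(1))` into `exp (t⁻¹ y L(1))` (`powLzero_expLone`), the operator `exp (x L(1))` turns the diagonal
action of `j^(-2 L(0))` into the full cocycle. Thus `P` sends `f ⊗ v` to a `V`-valued form, and
conversely the homogeneous coordinates of `exp (-x L(1)) F` are scalar modular forms
(`exists_coordForm`), which inverts `P`.

For the derivative, `d/dτ` acts on `f` and on `exp (x L(1))`. The second contribution is `2πi 𝔠 (θ
E₂) L(1)`, and Ramanujan's identity (`normalizedDeriv_E2`) replaces `θ E₂` by `(E₂² - E₄) / 12`.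
Moving `L(-1)` across `exp (x L(1))` (`expLone_Lneg`) produces a multiple of `x`, which accounts for
the `V`-part of the weight, and `-x² L(1)`, which is exactly the `E₂²` term because `2πi = -12 𝔠`.
Only `E₄` survives, so `P ∇' = ∇ P`. Stability of modular forms under `∇` and uniqueness of `∇'`
then follow from the bijectivity of `P`. -/

open Filter Topology

/-! ## Functions with a `q`-expansion -/

section QExpansion

theorem periodic_of_hasSum_qParam {f : ℍ → ℂ} {c : ℕ → ℂ}
    (hf : ∀ τ : ℍ, HasSum (fun m ↦ c m • Function.Periodic.qParam 1 τ ^ m) (f τ)) :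
    Function.Periodic (f ∘ ofComplex) (1 : ℝ) := by
  intro z
  by_cases hz : 0 < z.im
  · have hz' : 0 < (z + (1 : ℝ)).im := by simpa using hz
    simp only [Function.comp_apply, ofComplex_apply_of_im_pos hz, ofComplex_apply_of_im_pos hz']
    have h1 := hf ⟨z + (1 : ℝ), hz'⟩
    have h2 := hf ⟨z, hz⟩
    have h3 : Function.Periodic.qParam 1 (z + (1 : ℝ)) = Function.Periodic.qParam 1 z :=
      by
      simp [Function.Periodic.qParam, mul_add, Complex.exp_add]
    simp only [h3] at h1 h2
    exact h1.unique h2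
  -- Outside the upper half-plane `ofComplex` takes one fixed default value, so periodicity is
  -- trivial there.
  · have hz' : ¬ 0 < (z + (1 : ℝ)).im := by simpa using hz
    simp only [Function.comp_apply, ofComplex_apply_of_im_nonpos (not_lt.1 hz),
      ofComplex_apply_of_im_nonpos (not_lt.1 hz')]

/-- The constant coefficient is the value at `q = 0` of the function on the disc, and `f` approaches
it exponentially fast. The limits of `E₂` and `E₄` obtained this way fix the constant in Ramanujan's
identity. -/
theorem tendsto_atImInfty_of_hasSum_qParam {f : ℍ → ℂ} {c : ℕ → ℂ} (hm : MDiff f)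
    (hf : ∀ τ : ℍ, HasSum (fun m ↦ c m • Function.Periodic.qParam 1 τ ^ m) (f τ)) :
    Tendsto f atImInfty (𝓝 (c 0)) := by
  have hp := periodic_of_hasSum_qParam hf
  have hb := isBoundedAtImInfty_of_hasSum_qExpansion one_pos hf
  have ha := analyticAt_cuspFunction_zero one_pos hp hm hb
  have h0 := (hasFPowerSeriesOnBall_cuspFunction one_pos ha hf).hasFPowerSeriesAt.coeff_zero
    (fun _ => 0)
  rw [cuspFunction_apply_zero one_pos ha hp] at h0
  have h0' : c 0 = valueAtInfty f := by
    rw [← h0]; simp [FormalMultilinearSeries.ofScalars]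
  rw [h0', tendsto_iff_norm_sub_tendsto_zero]
  have h := (exp_decay_sub_atImInfty one_pos hp hm hb).norm_left
  refine h.trans_tendsto ?_
  have him : Tendsto (fun τ : ℍ => τ.im) atImInfty atTop := tendsto_comap
  refine Real.tendsto_exp_atBot.comp ?_
  have := him.const_mul_atTop_of_neg (r := -2 * Real.pi) (by nlinarith [Real.pi_pos])
  simpa using this

theorem hasSum_qParam_E2 (τ : ℍ) : HasSum (fun m : ℕ ↦
    (if m = 0 then 1 else -24 * ArithmeticFunction.sigma 1 m : ℂ) •
      Function.Periodic.qParam 1 τ ^ m) (EisensteinSeries.E2 τ) := by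
  simpa only [Function.Periodic.qParam, ofReal_one, div_one] using
    EisensteinSeries.hasSum_qExpansion_E2 (z := τ)

theorem periodic_E2 : Function.Periodic (EisensteinSeries.E2 ∘ ofComplex) (1 : ℝ) :=
  periodic_of_hasSum_qParam hasSum_qParam_E2

theorem tendsto_E2_atImInfty : Tendsto EisensteinSeries.E2 atImInfty (𝓝 1) :=
  tendsto_atImInfty_of_hasSum_qParam E2_mdifferentiable hasSum_qParam_E2

theorem tendsto_E₄_atImInfty : Tendsto ModularForm.E₄ atImInfty (𝓝 1) := by
  rw [← EisensteinSeries.E_qExpansion_coeff_zero (k := 4) (by norm_num) ⟨2, rfl⟩]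
  exact tendsto_atImInfty_of_hasSum_qParam ModularForm.E₄.holo' fun τ =>
    ModularForm.hasSum_qExpansion ModularForm.E₄ one_pos one_mem_strictPeriods_SL τ

end QExpansion

/-! ## Ramanujan's identity for `E₂` -/

section Ramanujan

open Derivative

/-- Cauchy's estimate for `f - a` on the disc of radius 1 about a point high in the half-plane. -/
theorem tendsto_normalizedDeriv_atImInfty {f : ℍ → ℂ} (hf : MDiff f)
    {a : ℂ} (hb : Tendsto f atImInfty (𝓝 a)) :
    Tendsto (normalizedDerivOfComplex f) atImInfty (𝓝 0) := by
  rw [tendsto_zero_iff_norm_tendsto_zero, Metric.tendsto_nhds]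
  intro ε hε
  have hb' := Metric.tendsto_nhds.1 hb ε hε
  rw [Filter.Eventually, UpperHalfPlane.atImInfty_mem] at hb' ⊢
  obtain ⟨R, h⟩ := hb'
  -- The closed unit disc about `z` then stays in `ℍ` and above height `R`.
  refine ⟨max R 0 + 2, fun z hz => ?_⟩
  have hz' : max R 0 + 2 ≤ (z : ℂ).im := hz
  have him : ∀ w ∈ Metric.closedBall (z : ℂ) 1, max R 0 < w.im := by
    intro w hw
    have h1 : |(w - z).im| ≤ 1 :=
      (Complex.abs_im_le_norm _).trans (by simpa [dist_eq_norm] using hw)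
    rw [Complex.sub_im, abs_le] at h1
    linarith [h1.1]
  have hd : DifferentiableOn ℂ (fun w => f (ofComplex w) - a) (Metric.closedBall (z : ℂ) 1) :=
    ((UpperHalfPlane.mdifferentiable_iff.1 hf).mono fun w hw =>
      lt_of_le_of_lt (le_max_right R 0) (him w hw)).sub_const a
  have hc := Complex.norm_deriv_le_of_forall_mem_sphere_norm_le (C := ε) one_pos
    (hd.diffContOnCl_ball subset_rfl) fun w hw => by
      have hw' := him w (Metric.sphere_subset_closedBall hw)
      have hpos : 0 < w.im := lt_of_le_of_lt (le_max_right R 0) hw'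
      rw [ofComplex_apply_of_im_pos hpos, ← dist_eq_norm]
      exact (h ⟨w, hpos⟩ ((le_max_left R 0).trans hw'.le)).le
  rw [deriv_sub_const, div_one] at hc
  -- The normalizing factor turns the non-strict Cauchy bound `ε` into a strict one.
  have h2 : ‖(2 * Real.pi * I : ℂ)⁻¹‖ < 1 := by
    rw [norm_inv, norm_mul, norm_mul, Complex.norm_I, mul_one, Complex.norm_real,
      Real.norm_of_nonneg Real.pi_pos.le]
    refine inv_lt_one_of_one_lt₀ ?_
    norm_num
    nlinarith [Real.pi_gt_three]
  simp only [Set.mem_ofPred_eq, dist_zero_right, norm_norm]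
  rw [normalizedDerivOfComplex, norm_mul]
  calc _ ≤ ‖(2 * Real.pi * I : ℂ)⁻¹‖ * ε := mul_le_mul_of_nonneg_left hc (norm_nonneg _)
    _ < 1 * ε := mul_lt_mul_of_pos_right h2 hε
    _ = ε := one_mul ε

theorem E2_slash_apply (γ : SL(2, ℤ)) (τ : ℍ) :
    (SlashAction.map (2 : ℤ) γ EisensteinSeries.E2) τ =
      EisensteinSeries.E2 τ + 12 / (2 * Real.pi * I) * ((γ 1 0 : ℤ) : ℂ) / denom γ τ := by
  rw [EisensteinSeries.E2_slash_action]
  have := Complex.ofReal_ne_zero.2 Real.pi_ne_zero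
  have hj := UpperHalfPlane.denom_ne_zero γ τ
  simp only [Pi.sub_apply, Pi.smul_apply, EisensteinSeries.D2, riemannZeta_two, smul_eq_mul]
  field_simp
  ring_nf
  simp only [I_sq]
  ring

theorem E2_smul (γ : SL(2, ℤ)) (τ : ℍ) :
    EisensteinSeries.E2 (γ • τ) = denom γ τ ^ 2 * EisensteinSeries.E2 τ +
      12 / (2 * Real.pi * I) * ((γ 1 0 : ℤ) : ℂ) * denom γ τ := by
  have h := E2_slash_apply γ τ
  have hj := UpperHalfPlane.denom_ne_zero γ τ
  rw [ModularForm.SL_slash_apply, zpow_neg, ← div_eq_mul_inv,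
    div_eq_iff (zpow_ne_zero _ hj)] at h
  rw [h]
  field_simp

/-- The parameter is 1 although `E₂` has weight 2. The derivative with parameter 2 commutes with the
slash action on all holomorphic functions, and the difference of the two is `E₂² / 12`. With `E₂ | γ
= E₂ + u`, where `u` is a multiple of `j⁻¹`, one has `θ u = -u² / 12`, so the terms in `u` and `u²`
cancel. -/
theorem serreDerivative_one_E2_slash (γ : SL(2, ℤ)) :
    SlashAction.map (4 : ℤ) γ (serreDerivative 1 EisensteinSeries.E2) =
      serreDerivative 1 EisensteinSeries.E2 := by
  have hsplit : serreDerivative 1 EisensteinSeries.E2 =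
      serreDerivative 2 EisensteinSeries.E2 +
        (12⁻¹ : ℂ) • (EisensteinSeries.E2 * EisensteinSeries.E2) := by
    ext z
    simp only [serreDerivative_apply, Pi.add_apply, Pi.smul_apply, Pi.mul_apply, smul_eq_mul]
    ring
  have h1 := serreDerivative_slash_equivariant (k := 2) E2_mdifferentiable (γ := γ)
  have h2 := ModularForm.mul_slash_SL2 2 2 γ EisensteinSeries.E2 EisensteinSeries.E2
  norm_num only [Int.cast_ofNat] at h1 h2
  ext τ
  have hα : SlashAction.map (2 : ℤ) γ EisensteinSeries.E2 = EisensteinSeries.E2 +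
      (12 / (2 * Real.pi * I) * ((γ 1 0 : ℤ) : ℂ)) • (fun τ : ℍ => denom γ τ ^ (-1 : ℤ)) := by
    ext z
    rw [E2_slash_apply]
    simp [div_eq_mul_inv]
  have hd := fun z : ℍ => hasDerivAt_denom_zpow (γ : GL (Fin 2) ℝ) (-1) z
  have heq : ∀ z : ℍ, (fun τ : ℍ => denom γ τ ^ (-1 : ℤ)) ∘ ofComplex =ᶠ[𝓝 (z : ℂ)]
      fun w => denom γ w ^ (-1 : ℤ) := fun z => by
    filter_upwards [isOpen_upperHalfPlaneSet.mem_nhds z.im_pos] with w hw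
    simp [ofComplex_apply_of_im_pos hw]
  have hm : MDiff (fun τ : ℍ => denom γ τ ^ (-1 : ℤ)) := fun z =>
    UpperHalfPlane.mdifferentiableAt_iff.2
      ((hd z).congr_of_eventuallyEq (heq z)).differentiableAt
  have hD : normalizedDerivOfComplex (fun τ : ℍ => denom γ τ ^ (-1 : ℤ)) τ =
      -(2 * Real.pi * I)⁻¹ * ((γ 1 0 : ℤ) : ℂ) * (denom γ τ ^ 2)⁻¹ := by
    rw [normalizedDerivOfComplex, ((hd τ).congr_of_eventuallyEq (heq τ)).deriv]
    have : (denom γ τ ^ (-1 - 1 : ℤ)) = (denom γ τ ^ 2)⁻¹ := by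
      rw [show (-1 - 1 : ℤ) = -(2 : ℕ) by norm_num, zpow_neg, zpow_natCast]
    rw [this]
    simp [mul_assoc]
  rw [hsplit, SlashAction.add_slash, h1, ModularForm.SL_smul_slash, h2, hα,
    serreDerivative_add _ _ _ E2_mdifferentiable (hm.const_smul _),
    serreDerivative_smul _ _ _ hm]
  simp only [Pi.add_apply, Pi.smul_apply, Pi.mul_apply, smul_eq_mul, serreDerivative_apply, hD]
  have := Complex.ofReal_ne_zero.2 Real.pi_ne_zero
  have hj := UpperHalfPlane.denom_ne_zero γ τ
  simp only [zpow_neg, zpow_one]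
  field_simp
  ring

/-- The Serre derivative of `E₂`, a modular form of weight `4`. -/
noncomputable def serreDerivE2 : ModularForm 𝒮ℒ 4 where
  toFun := serreDerivative 1 EisensteinSeries.E2
  slash_action_eq' := by
    rintro _ ⟨γ, rfl⟩
    exact serreDerivative_one_E2_slash γ
  holo' := serreDerivative_mdifferentiable _ E2_mdifferentiable
  bdd_at_cusps' := fun {c} hc => by
    rw [OnePoint.isBoundedAt_iff_forall_SL2Z hc]
    intro γ _
    refine (congrArg IsBoundedAtImInfty (serreDerivative_one_E2_slash γ)).mpr ?_
    exact isBoundedAtImInfty_serreDerivative _ E2_mdifferentiable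
      EisensteinSeries.isBoundedAtImInfty_E2

/-- Ramanujan's identity `θ E₂ = (E₂² - E₄) / 12`. -/
theorem normalizedDeriv_E2 (τ : ℍ) : normalizedDerivOfComplex EisensteinSeries.E2 τ =
    (EisensteinSeries.E2 τ ^ 2 - ModularForm.E₄ τ) / 12 := by
  -- Weight 4 is one-dimensional, so the Serre derivative of `E₂` is `c E₄`; limits at `i∞` give `c
  -- = 0 - 1 / 12`.
  obtain ⟨c, hc⟩ := (finrank_eq_one_iff_of_nonzero' ModularForm.E₄
    (EisensteinSeries.E_ne_zero _ ⟨2, rfl⟩)).mp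
      (Module.rank_eq_one_iff_finrank_eq_one.mp ModularForm.levelOne_weight_four_rank_one)
        serreDerivE2
  have hc' : ∀ z, c * ModularForm.E₄ z = normalizedDerivOfComplex EisensteinSeries.E2 z -
      1 * 12⁻¹ * EisensteinSeries.E2 z * EisensteinSeries.E2 z := fun z =>
    congrArg (fun f : ModularForm 𝒮ℒ 4 => f z) hc
  have h1 := tendsto_E₄_atImInfty.const_mul c
  have h2 := (tendsto_normalizedDeriv_atImInfty E2_mdifferentiable tendsto_E2_atImInfty).sub
    ((tendsto_E2_atImInfty.const_mul (1 * 12⁻¹)).mul tendsto_E2_atImInfty)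
  have hcv : c = -12⁻¹ := by
    have := tendsto_nhds_unique (h1.congr hc') h2
    simpa using this
  have := hc' τ
  rw [hcv] at this
  linear_combination -this

end Ramanujan

/-! ## The operators `exp (t L(1))` and `t ^ L(0)` -/

namespace QuasiVOA

variable {V : Type*} [AddCommGroup V] [Module ℂ V] (A : QuasiVOA V)

theorem Lone_pow_eq_zero_of_le {v : V} {n m : ℕ} (h : (A.Lone ^ n) v = 0) (hnm : n ≤ m) :
    (A.Lone ^ m) v = 0 := by
  obtain ⟨k, rfl⟩ := Nat.exists_eq_add_of_le hnm
  rw [add_comm, pow_add, Module.End.mul_apply, h, map_zero]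

theorem deg_le_filt {n N : ℤ} (h : n ≤ N) : A.deg n ≤ A.filt N :=
  le_iSup (fun n : {n : ℤ // n ≤ N} => A.deg n) ⟨n, h⟩

/-- The grading is bounded below, so one exponent works on all of `F_N V`; exponentials applied to
`F τ` thus become sums of a length independent of `τ`. -/
theorem exists_Lone_pow_eq_zero_filt (N : ℤ) : ∃ n : ℕ, ∀ v ∈ A.filt N, (A.Lone ^ n) v = 0 := by
  obtain ⟨n₀, h₀⟩ := A.deg_eq_bot
  refine ⟨(N - n₀ + 1).toNat, fun v hv => ?_⟩
  induction hv using Submodule.iSup_induction' with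
  | mem k v hv =>
    have h := A.Lone_pow_mem hv (N - n₀ + 1).toNat
    have hk := k.2
    rwa [h₀ _ (by omega), Submodule.mem_bot] at h
  | zero => simp
  | add x y _ _ hx hy => rw [map_add, hx, hy, add_zero]

theorem exists_mem_filt (v : V) : ∃ N, v ∈ A.filt N := by
  have hv : v ∈ ⨆ n, A.deg n := by
    rw [A.isInternal.submodule_iSup_eq_top]; trivial
  induction hv using Submodule.iSup_induction' with
  | mem k v hv => exact ⟨k, A.deg_le_filt le_rfl hv⟩
  | zero => exact ⟨0, zero_mem _⟩
  | add x y _ _ hx hy =>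
    obtain ⟨N, hx⟩ := hx
    obtain ⟨M, hy⟩ := hy
    have hmono : ∀ K, K ≤ max N M → A.filt K ≤ A.filt (max N M) := fun K hK =>
      iSup_le fun n => A.deg_le_filt (n.2.trans hK)
    exact ⟨max N M, add_mem (hmono _ (le_max_left _ _) hx) (hmono _ (le_max_right _ _) hy)⟩

theorem exists_Lone_pow_eq_zero (v : V) : ∃ n : ℕ, (A.Lone ^ n) v = 0 := by
  obtain ⟨N, hv⟩ := A.exists_mem_filt v
  obtain ⟨n, hn⟩ := A.exists_Lone_pow_eq_zero_filt N
  exact ⟨n, hn v hv⟩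

theorem Lone_pow_mem_filt {N : ℤ} {v : V} (hv : v ∈ A.filt N) (m : ℕ) :
    (A.Lone ^ m) v ∈ A.filt N := by
  induction hv using Submodule.iSup_induction' with
  | mem k v hv =>
    have hk := k.2
    exact A.deg_le_filt (by omega) (A.Lone_pow_mem hv m)
  | zero => simp
  | add x y _ _ hx hy => rw [map_add]; exact add_mem hx hy

theorem expLone_apply (t : ℂ) {v : V} {N : ℕ} (h : (A.Lone ^ N) v = 0) :
    A.expLone t v = ∑ n ∈ Finset.range N, (t ^ n / n.factorial) • (A.Lone ^ n) v := by
  change ∑ᶠ n : ℕ, (t ^ n / n.factorial) • (A.Lone ^ n) v = _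
  refine finsum_eq_sum_of_support_subset _ fun n hn => ?_
  by_contra hc
  simp only [Finset.coe_range, Set.mem_Iio, not_lt] at hc
  exact hn (by simp only [A.Lone_pow_eq_zero_of_le h hc, smul_zero])

theorem expLone_mem_filt (t : ℂ) {N : ℤ} {v : V} (hv : v ∈ A.filt N) :
    A.expLone t v ∈ A.filt N := by
  obtain ⟨n, hn⟩ := A.exists_Lone_pow_eq_zero v
  rw [A.expLone_apply t hn]
  exact Submodule.sum_mem _ fun m _ => Submodule.smul_mem _ _ (A.Lone_pow_mem_filt hv m)

theorem expLone_zero (v : V) : A.expLone 0 v = v := by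
  obtain ⟨n, hn⟩ := A.exists_Lone_pow_eq_zero v
  rw [A.expLone_apply 0 (A.Lone_pow_eq_zero_of_le hn n.le_succ), Finset.sum_range_succ']
  simp

theorem expLone_Lone (t : ℂ) (v : V) : A.expLone t (A.Lone v) = A.Lone (A.expLone t v) := by
  obtain ⟨n, hn⟩ := A.exists_Lone_pow_eq_zero v
  have hn' : (A.Lone ^ n) (A.Lone v) = 0 := by
    rw [← Module.End.mul_apply, ← pow_succ]
    exact A.Lone_pow_eq_zero_of_le hn n.le_succ
  rw [A.expLone_apply t hn, A.expLone_apply t hn', map_sum]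
  refine Finset.sum_congr rfl fun m _ => ?_
  rw [map_smul, ← Module.End.mul_apply, ← Module.End.mul_apply, ← pow_succ, ← pow_succ']

/-- The binomial theorem gives a sum over the triangle `i + j < N`, which may be completed to a
square because `L(1)^(i + j) v` vanishes beyond it. -/
theorem expLone_add (s t : ℂ) (v : V) :
    A.expLone (s + t) v = A.expLone s (A.expLone t v) := by
  obtain ⟨N, hN⟩ := A.exists_Lone_pow_eq_zero v
  have hN' : ∀ j, (A.Lone ^ N) ((A.Lone ^ j) v) = 0 := fun j => by
    rw [← Module.End.mul_apply, ← pow_add]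
    exact A.Lone_pow_eq_zero_of_le hN (Nat.le_add_right _ _)
  set f : ℕ → ℕ → V := fun i j =>
    (s ^ j / j.factorial * (t ^ i / i.factorial)) • (A.Lone ^ (i + j)) v with hf
  have h1 : A.expLone (s + t) v =
      ∑ m ∈ Finset.range N, ∑ k ∈ Finset.range (m + 1), f k (m - k) := by
    rw [A.expLone_apply _ hN]
    refine Finset.sum_congr rfl fun m _ => ?_
    rw [add_comm s t, add_pow, Finset.sum_div, Finset.sum_smul]
    refine Finset.sum_congr rfl fun k hk => ?_
    have hkm : k ≤ m := Nat.lt_succ_iff.1 (Finset.mem_range.1 hk)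
    rw [hf]
    simp only
    rw [Nat.add_sub_cancel' hkm]
    congr 1
    have h2 : (m.factorial : ℂ) = m.choose k * k.factorial * (m - k).factorial := by
      exact_mod_cast (Nat.choose_mul_factorial_mul_factorial hkm).symm
    have h3 : (m.choose k : ℂ) ≠ 0 := by exact_mod_cast (Nat.choose_pos hkm).ne'
    have h4 : (k.factorial : ℂ) ≠ 0 := by exact_mod_cast k.factorial_ne_zero
    have h5 : ((m - k).factorial : ℂ) ≠ 0 := by exact_mod_cast (m - k).factorial_ne_zero
    rw [h2]
    field_simp
  rw [h1, Finset.sum_range_diag_flip, A.expLone_apply t hN, map_sum]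
  refine Finset.sum_congr rfl fun i _ => ?_
  rw [map_smul, A.expLone_apply s (hN' i), Finset.smul_sum]
  rw [Finset.sum_subset (Finset.range_mono (Nat.sub_le N i))]
  · refine Finset.sum_congr rfl fun j _ => ?_
    rw [hf]
    simp only
    rw [add_comm i j, pow_add, Module.End.mul_apply, smul_smul, mul_comm]
  · intro j _ hj
    rw [hf]
    simp only
    rw [A.Lone_pow_eq_zero_of_le hN, smul_zero]
    simp only [Finset.mem_range, not_lt] at hj
    omega

theorem expLone_neg_expLone (t : ℂ) (v : V) : A.expLone (-t) (A.expLone t v) = v := by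
  rw [← expLone_add, neg_add_cancel, expLone_zero]

theorem expLone_expLone_neg (t : ℂ) (v : V) : A.expLone t (A.expLone (-t) v) = v := by
  rw [← expLone_add, add_neg_cancel, expLone_zero]

theorem powLzero_apply (t : ℂ) {n : ℤ} {v : V} (hv : v ∈ A.deg n) :
    A.powLzero t v = t ^ n • v := by
  have h : A.decomp v = DirectSum.lof ℂ ℤ (fun n => A.deg n) n ⟨v, hv⟩ := by
    rw [decomp, LinearEquiv.symm_apply_eq]
    exact (DirectSum.coeLinearMap_lof A.deg n ⟨v, hv⟩).symm
  rw [powLzero, LinearMap.comp_apply, LinearEquiv.coe_coe, h, DirectSum.toModule_lof]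
  simp

theorem hom_ext_deg {W : Type*} [AddCommGroup W] [Module ℂ W] {f g : V →ₗ[ℂ] W}
    (h : ∀ n, ∀ v ∈ A.deg n, f v = g v) : f = g := by
  ext v
  have hv : v ∈ ⨆ n, A.deg n := by
    rw [A.isInternal.submodule_iSup_eq_top]; trivial
  induction hv using Submodule.iSup_induction' with
  | mem k v hv => exact h k v hv
  | zero => simp
  | add x y _ _ hx hy => rw [map_add, map_add, hx, hy]

/-- On degree `n`, `L(1)^m` lands in degree `n - m`, so each power of `L(1)` costs one factor `t⁻¹`.
-/
theorem powLzero_expLone {t : ℂ} (ht : t ≠ 0) (x : ℂ) (v : V) :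
    A.powLzero t (A.expLone x v) = A.expLone (x * t⁻¹) (A.powLzero t v) := by
  have h : A.powLzero t ∘ₗ A.expLone x = A.expLone (x * t⁻¹) ∘ₗ A.powLzero t := by
    refine A.hom_ext_deg fun n v hv => ?_
    obtain ⟨N, hN⟩ := A.exists_Lone_pow_eq_zero v
    rw [LinearMap.comp_apply, LinearMap.comp_apply, A.powLzero_apply t hv, map_smul,
      A.expLone_apply _ hN, A.expLone_apply _ hN, map_sum, Finset.smul_sum]
    refine Finset.sum_congr rfl fun m _ => ?_
    rw [map_smul, A.powLzero_apply t (A.Lone_pow_mem hv m), smul_smul, smul_smul, zpow_sub₀ ht,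
      zpow_natCast, mul_pow, inv_pow]
    congr 1
    field_simp
  exact LinearMap.congr_fun h v

theorem Lneg_mem {k : ℤ} {v : V} (hv : v ∈ A.deg k) : A.Lneg v ∈ A.deg (k + 1) := by
  apply A.mem_deg_of_Lzero
  have h := LinearMap.congr_fun A.bracket_zero_neg v
  rw [Ring.lie_def, LinearMap.sub_apply, Module.End.mul_apply, Module.End.mul_apply,
    A.Lzero_apply k v hv, map_smul] at h
  push_cast
  rw [add_smul, one_smul]
  exact sub_eq_iff_eq_add'.1 h

/-- The usual `sl₂` computation: each commutator contributes `2 L(0)`, and the eigenvalues `2 (k -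
i)` for `0 ≤ i ≤ m` add up to `(m + 1) (2 k - m)`. -/
theorem Lone_pow_Lneg {k : ℤ} {v : V} (hv : v ∈ A.deg k) (m : ℕ) :
    (A.Lone ^ (m + 1)) (A.Lneg v) = A.Lneg ((A.Lone ^ (m + 1)) v) +
      ((m + 1) * (2 * k - m) : ℂ) • (A.Lone ^ m) v := by
  have hcomm : ∀ w, A.Lone (A.Lneg w) = A.Lneg (A.Lone w) + (2 : ℂ) • A.Lzero w := fun w => by
    have h := LinearMap.congr_fun A.bracket_one_neg w
    rw [Ring.lie_def, LinearMap.sub_apply, Module.End.mul_apply, Module.End.mul_apply] at h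
    exact sub_eq_iff_eq_add'.1 h
  have hpow : ∀ w m, A.Lone ((A.Lone ^ m) w) = (A.Lone ^ (m + 1)) w := fun w m => by
    rw [pow_succ' A.Lone, Module.End.mul_apply]
  induction m with
  | zero => simp [hcomm, A.Lzero_apply k v hv, smul_smul]
  | succ m ih =>
    rw [← hpow, ih, map_add, map_smul, hcomm,
      A.Lzero_apply _ _ (A.Lone_pow_mem hv (m + 1)), hpow, hpow, add_assoc, smul_smul, ← add_smul]
    congr 2
    push_cast
    ring

/-- Summing `Lone_pow_Lneg` against `x^(m+1) / (m+1)!`, the part `2 k` of the coefficient rebuilds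
the exponential times `2 k x`, and the part `-m` shifts the index and gives `-x² L(1)`. -/
theorem expLone_Lneg (x : ℂ) {k : ℤ} {v : V} (hv : v ∈ A.deg k) :
    A.expLone x (A.Lneg v) = A.Lneg (A.expLone x v) + (2 * k * x) • A.expLone x v -
      x ^ 2 • A.Lone (A.expLone x v) := by
  obtain ⟨N, hN⟩ := A.exists_Lone_pow_eq_zero v
  obtain ⟨M, hM⟩ := A.exists_Lone_pow_eq_zero (A.Lneg v)
  set K := max N M
  have hv0 : ∀ m, K ≤ m → (A.Lone ^ m) v = 0 := fun m hm =>
    A.Lone_pow_eq_zero_of_le hN ((le_max_left _ _).trans hm)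
  have hw0 : ∀ m, K ≤ m → (A.Lone ^ m) (A.Lneg v) = 0 := fun m hm =>
    A.Lone_pow_eq_zero_of_le hM ((le_max_right _ _).trans hm)
  have hfac : ∀ m : ℕ, ((m + 1).factorial : ℂ) = (m + 1) * m.factorial := fun m => by
    rw [Nat.factorial_succ]; push_cast; rfl
  have hf0 : ∀ m : ℕ, (m.factorial : ℂ) ≠ 0 := fun m => by exact_mod_cast m.factorial_ne_zero
  have hm0 : ∀ m : ℕ, (m + 1 : ℂ) ≠ 0 := fun m => by exact_mod_cast m.succ_ne_zero
  have hsucc : ∀ m : ℕ, (x ^ (m + 1) / (m + 1).factorial) • (A.Lone ^ (m + 1)) (A.Lneg v) =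
      A.Lneg ((x ^ (m + 1) / (m + 1).factorial) • (A.Lone ^ (m + 1)) v) +
      ((2 * k * x) • ((x ^ m / m.factorial) • (A.Lone ^ m) v) -
        (x * m) • ((x ^ m / m.factorial) • (A.Lone ^ m) v)) := fun m => by
    rw [A.Lone_pow_Lneg hv, smul_add, map_smul, smul_smul, smul_smul, smul_smul, ← sub_smul, hfac]
    congr 2
    have := hf0 m
    have := hm0 m
    field_simp
    ring
  have hlast : ∑ m ∈ Finset.range (K + 1), (x * m) • ((x ^ m / m.factorial) • (A.Lone ^ m) v) =
      x ^ 2 • A.Lone (A.expLone x v) := by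
    rw [Finset.sum_range_succ', A.expLone_apply x (hv0 K le_rfl), map_sum, Finset.smul_sum]
    simp only [Nat.cast_zero, mul_zero, zero_smul, add_zero]
    refine Finset.sum_congr rfl fun m _ => ?_
    rw [map_smul, smul_smul, smul_smul, pow_succ' A.Lone, Module.End.mul_apply, hfac]
    congr 1
    have := hf0 m
    have := hm0 m
    push_cast
    field_simp
    ring
  have hfirst : A.Lneg (A.expLone x v) = A.Lneg v + ∑ m ∈ Finset.range (K + 1),
      A.Lneg ((x ^ (m + 1) / (m + 1).factorial) • (A.Lone ^ (m + 1)) v) := by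
    rw [A.expLone_apply x (hv0 (K + 2) (by omega)), Finset.sum_range_succ', map_add, map_sum,
      add_comm]
    simp
  -- The cutoff `K + 2` leaves `K + 1` terms after the zeroth is removed; `hlast` removes one more,
  -- and `K` terms still suffice.
  rw [A.expLone_apply x (hw0 (K + 2) (by omega)), Finset.sum_range_succ',
    Finset.sum_congr rfl fun m _ => hsucc m, Finset.sum_add_distrib, Finset.sum_sub_distrib,
    ← Finset.smul_sum, ← A.expLone_apply x (hv0 (K + 1) (by omega)), hlast, hfirst]
  simp only [pow_zero, Nat.factorial_zero, Nat.cast_one, div_one, one_smul,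
    Module.End.one_apply]
  abel

theorem hasDerivAt_expLone {g : ℂ → ℂ} {g' z : ℂ} (hg : HasDerivAt g g' z) (v : V)
    (φ : Module.Dual ℂ V) : HasDerivAt (fun w => φ (A.expLone (g w) v))
      (φ (g' • A.Lone (A.expLone (g z) v))) z := by
  obtain ⟨N, hN⟩ := A.exists_Lone_pow_eq_zero v
  have h1 : ∀ t, φ (A.expLone t v) =
      ∑ n ∈ Finset.range (N + 1), t ^ n / n.factorial * φ ((A.Lone ^ n) v) := fun t => by
    rw [A.expLone_apply t (A.Lone_pow_eq_zero_of_le hN N.le_succ), map_sum]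
    simp
  -- The factor `n` kills the term `n = 0`, where `n - 1` is truncated; the other terms are `L(1)`
  -- applied to the exponential series.
  have h2 : φ (g' • A.Lone (A.expLone (g z) v)) =
      ∑ n ∈ Finset.range (N + 1), n * g z ^ (n - 1) * g' / n.factorial * φ ((A.Lone ^ n) v) := by
    rw [A.expLone_apply _ hN, Finset.sum_range_succ', map_sum, Finset.smul_sum, map_sum]
    simp only [Nat.cast_zero, zero_mul, zero_div, add_zero]
    refine Finset.sum_congr rfl fun m _ => ?_
    rw [map_smul, map_smul, map_smul, pow_succ', Module.End.mul_apply, Nat.factorial_succ]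
    have := (by exact_mod_cast m.factorial_ne_zero : (m.factorial : ℂ) ≠ 0)
    have := (by exact_mod_cast m.succ_ne_zero : (m + 1 : ℂ) ≠ 0)
    push_cast
    simp only [smul_eq_mul]
    field_simp
  rw [h2]
  simp only [h1]
  exact HasDerivAt.fun_sum fun n _ => ((hg.fun_pow n).div_const _).mul_const _

end QuasiVOA

/-! ## The map `P` takes values in modular forms -/

theorem LevelOneForms.toFun_of {r : ℤ} (f : ModularForm 𝒮ℒ r) :
    LevelOneForms.toFun (DirectSum.of (fun k : ℤ => ModularForm 𝒮ℒ k) r f) = f :=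
  DirectSum.toModule_lof ℂ r f

theorem levelOne_smul_apply {r : ℤ} (f : ModularForm 𝒮ℒ r) (γ : SL(2, ℤ)) (τ : ℍ) :
    f (γ • τ) = denom γ τ ^ r * f τ :=
  SlashInvariantForm.slash_action_eqn'' f (MonoidHom.mem_range.2 ⟨γ, rfl⟩) τ

/-- The value of `𝔠` is dictated by `12 𝔠 / (2πi) = -1`: the anomaly becomes precisely the exponent
in the cocycle. -/
theorem frakC_mul_E2_smul (γ : SL(2, ℤ)) (τ : ℍ) :
    frakC * EisensteinSeries.E2 (γ • τ) = -((γ 1 0 : ℤ) : ℂ) * denom γ τ +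
      denom γ τ ^ 2 * (frakC * EisensteinSeries.E2 τ) := by
  rw [E2_smul, frakC]
  have := Complex.ofReal_ne_zero.2 Real.pi_ne_zero
  field_simp
  ring

theorem mdifferentiable_frakC_mul_E2 : MDiff (fun τ : ℍ => frakC * EisensteinSeries.E2 τ) :=
  mdifferentiable_const.mul E2_mdifferentiable

theorem isBoundedAtImInfty_frakC_mul_E2 :
    IsBoundedAtImInfty (fun τ : ℍ => frakC * EisensteinSeries.E2 τ) :=
  (Filter.const_boundedAtFilter atImInfty frakC).mul EisensteinSeries.isBoundedAtImInfty_E2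

theorem UpperHalfPlane.IsBoundedAtImInfty.pow {f : ℍ → ℂ} (hf : IsBoundedAtImInfty f) (m : ℕ) :
    IsBoundedAtImInfty (fun τ => f τ ^ m) := by
  induction m with
  | zero =>
    simp only [pow_zero]
    exact Filter.const_boundedAtFilter atImInfty (1 : ℂ)
  | succ m ih => simpa only [pow_succ] using! ih.mul hf

theorem mdifferentiable_finset_sum {ι : Type*} (s : Finset ι) {f : ι → ℍ → ℂ}
    (h : ∀ i ∈ s, MDiff (f i)) : MDiff (fun τ => ∑ i ∈ s, f i τ) := by
  classical
  induction s using Finset.induction_on with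
  | empty => simpa using mdifferentiable_const
  | insert a s ha ih =>
    simp only [Finset.sum_insert ha]
    exact (h a (Finset.mem_insert_self _ _)).add
      (ih fun i hi => h i (Finset.mem_insert_of_mem hi))

theorem isBoundedAtImInfty_finset_sum {ι : Type*} (s : Finset ι) {f : ι → ℍ → ℂ}
    (h : ∀ i ∈ s, IsBoundedAtImInfty (f i)) : IsBoundedAtImInfty (fun τ => ∑ i ∈ s, f i τ) := by
  classical
  induction s using Finset.induction_on with
  | empty =>
    simp only [Finset.sum_empty]
    exact Filter.const_boundedAtFilter atImInfty (0 : ℂ)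
  | insert a s ha ih =>
    simp only [Finset.sum_insert ha]
    exact (h a (Finset.mem_insert_self _ _)).add
      (ih fun i hi => h i (Finset.mem_insert_of_mem hi))

namespace QuasiVOA

variable {V : Type*} [AddCommGroup V] [Module ℂ V] (A : QuasiVOA V)

theorem P_of_tmul_apply {r : ℤ} (f : ModularForm 𝒮ℒ r) (v : V) (τ : ℍ) :
    A.P (DirectSum.of (fun k : ℤ => ModularForm 𝒮ℒ k) r f ⊗ₜ[ℂ] v) τ =
      f τ • A.expLone (frakC * EisensteinSeries.E2 τ) v := by
  rw [P, TensorProduct.lift.tmul, LinearMap.mk₂_apply, LevelOneForms.toFun_of]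

theorem P_of_tmul_mem {r n : ℤ} (f : ModularForm 𝒮ℒ r) {v : V} (hv : v ∈ A.deg n) :
    A.P (DirectSum.of (fun k : ℤ => ModularForm 𝒮ℒ k) r f ⊗ₜ[ℂ] v) ∈
      A.modularForms (r + 2 * n) := by
  obtain ⟨N, hN⟩ := A.exists_Lone_pow_eq_zero v
  have hvf : v ∈ A.filt n := A.deg_le_filt le_rfl hv
  -- These coefficients of `L(1)^m v` need not be modular, but they are holomorphic, 1-periodic and
  -- bounded at `i∞`, which suffices for a `q`-expansion.
  set g : ℕ → ℍ → ℂ := fun m τ => f τ * ((frakC * EisensteinSeries.E2 τ) ^ m * (m.factorial : ℂ)⁻¹)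
    with hg
  have hφ : ∀ (φ : Module.Dual ℂ V) (τ : ℍ),
      φ (A.P (DirectSum.of (fun k : ℤ => ModularForm 𝒮ℒ k) r f ⊗ₜ[ℂ] v) τ) =
        ∑ m ∈ Finset.range N, g m τ * φ ((A.Lone ^ m) v) := fun φ τ => by
    rw [P_of_tmul_apply, A.expLone_apply _ hN, map_smul, map_sum, Finset.smul_sum]
    refine Finset.sum_congr rfl fun m _ => ?_
    rw [map_smul, smul_smul, smul_eq_mul, div_eq_mul_inv]
  have hgm : ∀ m, MDiff (g m) := fun m =>
    f.holo'.mul ((mdifferentiable_frakC_mul_E2.pow m).mul mdifferentiable_const)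
  have hgb : ∀ m, IsBoundedAtImInfty (g m) := fun m =>
    (ModularFormClass.bdd_at_infty f).mul ((isBoundedAtImInfty_frakC_mul_E2.pow m).mul
      (Filter.const_boundedAtFilter atImInfty _))
  have hgp : ∀ m, Function.Periodic (g m ∘ ofComplex) (1 : ℝ) := fun m z => by
    have h1 := SlashInvariantFormClass.periodic_comp_ofComplex f one_mem_strictPeriods_SL z
    have h2 := periodic_E2 z
    simp only [Function.comp_apply] at h1 h2
    simp only [hg, Function.comp_apply, h1, h2]
  refine ⟨n, fun τ => ?_, fun φ => ?_, fun γ τ => ?_,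
    fun i => ∑ m ∈ Finset.range N, (qExpansion 1 (g m)).coeff i • (A.Lone ^ m) v,
    fun i => ?_, fun φ τ => ?_⟩
  · rw [P_of_tmul_apply]
    exact Submodule.smul_mem _ _ (A.expLone_mem_filt _ hvf)
  · simp only [hφ]
    exact mdifferentiable_finset_sum _ fun m _ => (hgm m).mul mdifferentiable_const
  · have hj := UpperHalfPlane.denom_ne_zero γ τ
    have hj2 : denom γ τ ^ (-2 : ℤ) ≠ 0 := zpow_ne_zero _ hj
    have hj3 : (denom γ τ ^ (-2 : ℤ))⁻¹ = denom γ τ ^ 2 := by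
      rw [zpow_neg, inv_inv]; rfl
    -- The factor `exp (-c j L(1))` splits off, and `exp (j² x L(1))` comes from moving `j^(-2
    -- L(0))` past `exp (x L(1))`. On `V_n` the latter also gives `j^(-2n)`, whence the weight `r +
    -- 2 n`.
    rw [P_of_tmul_apply, P_of_tmul_apply, levelOne_smul_apply, frakC_mul_E2_smul, expLone_add,
      cocycle, LinearMap.comp_apply, map_smul, A.powLzero_expLone hj2, A.powLzero_apply _ hv,
      map_smul, map_smul, map_smul, smul_smul, smul_smul, hj3, mul_comm (denom γ τ ^ 2),
      ← zpow_mul, show denom γ τ ^ r = denom γ τ ^ (r + 2 * n) * denom γ τ ^ (-2 * n) by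
        rw [← zpow_add₀ hj]; congr 1; ring, mul_right_comm]
  · exact Submodule.sum_mem _ fun m _ => Submodule.smul_mem _ _ (A.Lone_pow_mem_filt hvf m)
  · rw [hφ]
    simp only [map_sum, map_smul, Finset.sum_mul]
    refine hasSum_sum fun m _ => ?_
    convert! (hasSum_qExpansion one_pos (hgp m) (hgm m) (hgb m) τ).mul_right
      (φ ((A.Lone ^ m) v)) using 2 with i
    simp only [Function.Periodic.qParam, ofReal_one, div_one, smul_eq_mul]
    ring

theorem P_mem_modularForms {k : ℤ} {x : LevelOneForms ⊗[ℂ] V} (hx : x ∈ A.weightPart k) :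
    A.P x ∈ A.modularForms k := by
  induction hx using Submodule.span_induction with
  | mem x hx =>
    obtain ⟨r, n, f, v, rfl, hv, rfl⟩ := hx
    exact A.P_of_tmul_mem f hv
  | zero => simp
  | add x y _ _ hx hy => rw [map_add]; exact add_mem hx hy
  | smul c x _ hx => rw [map_smul]; exact Submodule.smul_mem _ c hx

/-! ## Bijectivity of `P` -/

/-- A basis of the Fock space consisting of homogeneous vectors. -/
noncomputable def gradedBasis : Module.Basis (Σ n, Fin (Module.finrank ℂ (A.deg n))) ℂ V :=
  A.isInternal.collectedBasis fun n =>
    haveI := A.finite_deg n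
    Module.finBasis ℂ (A.deg n)

theorem gradedBasis_mem (j : Σ n, Fin (Module.finrank ℂ (A.deg n))) :
    A.gradedBasis j ∈ A.deg j.1 :=
  A.isInternal.collectedBasis_mem _ j

theorem gradedBasis_repr_of_mem_ne {n : ℤ} {v : V} (hv : v ∈ A.deg n)
    {j : Σ n, Fin (Module.finrank ℂ (A.deg n))} (hj : j.1 ≠ n) : A.gradedBasis.repr v j = 0 := by
  obtain ⟨m, a⟩ := j
  exact A.isInternal.collectedBasis_repr_of_mem_ne _ (Ne.symm hj) hv

theorem gradedBasis_coord_powLzero (t : ℂ) (v : V)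
    (j : Σ n, Fin (Module.finrank ℂ (A.deg n))) :
    A.gradedBasis.coord j (A.powLzero t v) = t ^ j.1 * A.gradedBasis.coord j v := by
  have h : A.gradedBasis.coord j ∘ₗ A.powLzero t = t ^ j.1 • A.gradedBasis.coord j := by
    refine A.hom_ext_deg fun n v hv => ?_
    rw [LinearMap.comp_apply, A.powLzero_apply t hv, map_smul, LinearMap.smul_apply]
    by_cases hn : j.1 = n
    · rw [hn]
    · rw [Module.Basis.coord_apply, A.gradedBasis_repr_of_mem_ne hv hn, smul_zero, smul_zero]
  exact LinearMap.congr_fun h v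

/-- Finitely many basis vectors serve all of `F_N V` at once, so a form with values there is a
finite combination indexed independently of `τ`. -/
theorem exists_finset_gradedBasis_repr (N : ℤ) :
    ∃ S : Finset (Σ n, Fin (Module.finrank ℂ (A.deg n))), ∀ v ∈ A.filt N,
      v = ∑ j ∈ S, A.gradedBasis.coord j v • A.gradedBasis j := by
  obtain ⟨n₀, h₀⟩ := A.deg_eq_bot
  refine ⟨(Finset.Icc n₀ N).sigma fun _ => Finset.univ, fun v hv => ?_⟩
  suffices h : ∀ j, A.gradedBasis.repr v j ≠ 0 → j.1 ∈ Finset.Icc n₀ N by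
    conv_lhs => rw [← A.gradedBasis.linearCombination_repr v, Finsupp.linearCombination_apply]
    refine Finsupp.sum_of_support_subset _ (fun j hj => ?_) _ (by simp)
    exact Finset.mem_sigma.2 ⟨h j (Finsupp.mem_support_iff.1 hj), Finset.mem_univ _⟩
  intro j hj
  rw [Finset.mem_Icc]
  constructor
  · by_contra hlt
    have h1 := A.gradedBasis_mem j
    rw [h₀ _ (not_le.1 hlt), Submodule.mem_bot] at h1
    exact A.gradedBasis.ne_zero j h1
  · by_contra hlt
    refine hj ?_
    clear hj
    induction hv using Submodule.iSup_induction' with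
    | mem n v hv =>
      have hn := n.2
      exact A.gradedBasis_repr_of_mem_ne hv (by omega)
    | zero => simp
    | add x y _ _ hx hy => rw [map_add, Finsupp.add_apply, hx, hy, add_zero]

/-- The family `(f_j)` of modular forms corresponds to the tensor `∑ f_j ⊗ b_j`, where `(b_j)` is
the homogeneous basis of the Fock space. -/
noncomputable def tensorOfCoords (k : ℤ) :
    (⨁ j : Σ n, Fin (Module.finrank ℂ (A.deg n)), ModularForm 𝒮ℒ (k - 2 * j.1)) →ₗ[ℂ]
      LevelOneForms ⊗[ℂ] V :=
  open scoped Classical in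
  DirectSum.toModule ℂ _ _ fun j =>
    (TensorProduct.mk ℂ LevelOneForms V).flip (A.gradedBasis j) ∘ₗ
      DirectSum.lof ℂ ℤ (fun k : ℤ => ModularForm 𝒮ℒ k) (k - 2 * j.1)

open scoped Classical in
theorem tensorOfCoords_lof (k : ℤ) (j : Σ n, Fin (Module.finrank ℂ (A.deg n)))
    (f : ModularForm 𝒮ℒ (k - 2 * j.1)) :
    A.tensorOfCoords k (DirectSum.lof ℂ _
      (fun j : Σ n, Fin (Module.finrank ℂ (A.deg n)) => ModularForm 𝒮ℒ (k - 2 * j.1)) j f) =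
      DirectSum.of (fun k : ℤ => ModularForm 𝒮ℒ k) (k - 2 * j.1) f ⊗ₜ[ℂ] A.gradedBasis j := by
  rw [tensorOfCoords, DirectSum.toModule_lof]
  rfl

theorem weightPart_le_range_tensorOfCoords (k : ℤ) :
    A.weightPart k ≤ LinearMap.range (A.tensorOfCoords k) := by
  classical
  refine Submodule.span_le.2 ?_
  rintro _ ⟨r, n, f, v, hk, hv, rfl⟩
  obtain ⟨S, hS⟩ := A.exists_finset_gradedBasis_repr n
  rw [hS v (A.deg_le_filt le_rfl hv), TensorProduct.tmul_sum]
  refine Submodule.sum_mem _ fun j _ => ?_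
  rw [TensorProduct.tmul_smul]
  by_cases hj : j.1 = n
  -- Only basis vectors of degree `n` occur in `v`, and for these the weight of `f` is the one
  -- prescribed by `j`.
  · obtain rfl : r = k - 2 * j.1 := by omega
    exact Submodule.smul_mem _ _ ⟨_, A.tensorOfCoords_lof k j f⟩
  · rw [Module.Basis.coord_apply, A.gradedBasis_repr_of_mem_ne hv hj, zero_smul]
    exact zero_mem _

/-- An explicit left inverse: undoing the exponential and reading off coordinates recovers each
scalar form, so `P` is injective on a weight part. -/
theorem coord_expLone_P_tensorOfCoords {k : ℤ}
    (g : ⨁ j : Σ n, Fin (Module.finrank ℂ (A.deg n)), ModularForm 𝒮ℒ (k - 2 * j.1)) (τ : ℍ)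
    (j : Σ n, Fin (Module.finrank ℂ (A.deg n))) :
    A.gradedBasis.coord j (A.expLone (-(frakC * EisensteinSeries.E2 τ))
      (A.P (A.tensorOfCoords k g) τ)) = g j τ := by
  classical
  induction g using DirectSum.induction_on with
  | zero => simp
  | of i f =>
    rw [← DirectSum.lof_eq_of ℂ, tensorOfCoords_lof, P_of_tmul_apply, map_smul,
      expLone_neg_expLone, map_smul, Module.Basis.coord_apply, Module.Basis.repr_self]
    by_cases hij : i = j
    · subst hij
      rw [Finsupp.single_eq_same, smul_eq_mul, mul_one, DirectSum.lof_eq_of, DirectSum.of_eq_same]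
    · rw [Finsupp.single_eq_of_ne (Ne.symm hij), DirectSum.lof_eq_of,
        DirectSum.of_eq_of_ne _ _ _ (Ne.symm hij)]
      simp
  | add x y hx hy =>
    rw [map_add, map_add, Pi.add_apply, map_add, map_add, hx, hy]
    rfl

theorem eq_zero_of_P_eq_zero {k : ℤ} {x : LevelOneForms ⊗[ℂ] V} (hx : x ∈ A.weightPart k)
    (h : A.P x = 0) : x = 0 := by
  obtain ⟨g, rfl⟩ := A.weightPart_le_range_tensorOfCoords k hx
  have hg : g = 0 := by
    refine DFinsupp.ext fun j => ?_
    refine DFunLike.ext _ _ fun τ => ?_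
    rw [← A.coord_expLone_P_tensorOfCoords g τ j, h]
    simp
  rw [hg, map_zero]

/-- The coordinates of `exp (-𝔠 E₂ L(1)) F` in the homogeneous basis are scalar modular forms. -/
theorem exists_coordForm {k : ℤ} {F : ℍ → V} (hF : F ∈ A.modularForms k)
    (j : Σ n, Fin (Module.finrank ℂ (A.deg n))) :
    ∃ h : ModularForm 𝒮ℒ (k - 2 * j.1), ∀ τ, h τ =
      A.gradedBasis.coord j (A.expLone (-(frakC * EisensteinSeries.E2 τ)) (F τ)) := by
  obtain ⟨N, hN, hm, hs, a, -, ha⟩ := hF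
  obtain ⟨M, hM⟩ := A.exists_Lone_pow_eq_zero_filt N
  set h : ℍ → ℂ := fun τ =>
    A.gradedBasis.coord j (A.expLone (-(frakC * EisensteinSeries.E2 τ)) (F τ)) with hh
  have hsum : h = fun τ => ∑ m ∈ Finset.range M,
      ((frakC * EisensteinSeries.E2 τ) ^ m * ((-1) ^ m / m.factorial)) *
        (A.gradedBasis.coord j ∘ₗ A.Lone ^ m) (F τ) := by
    ext τ
    rw [hh]
    simp only
    rw [A.expLone_apply _ (hM _ (hN τ)), map_sum]
    refine Finset.sum_congr rfl fun m _ => ?_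
    rw [map_smul, smul_eq_mul, LinearMap.comp_apply, neg_pow]
    ring
  have hmd : MDiff h := by
    rw [hsum]
    exact mdifferentiable_finset_sum _ fun m _ =>
      ((mdifferentiable_frakC_mul_E2.pow m).mul mdifferentiable_const).mul (hm _)
  have hbd : IsBoundedAtImInfty h := by
    rw [hsum]
    refine isBoundedAtImInfty_finset_sum _ fun m _ =>
      ((isBoundedAtImInfty_frakC_mul_E2.pow m).mul
        (Filter.const_boundedAtFilter atImInfty _)).mul ?_
    -- Boundedness comes from the absence of negative powers of `q` in the expansion of `F`.
    refine isBoundedAtImInfty_of_hasSum_qExpansion one_pos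
      (c := fun n => (A.gradedBasis.coord j ∘ₗ A.Lone ^ m) (a n)) fun τ => ?_
    simpa only [Function.Periodic.qParam, ofReal_one, div_one, smul_eq_mul] using ha _ τ
  have hsl : ∀ γ : SL(2, ℤ), SlashAction.map (k - 2 * j.1) γ h = h := fun γ => by
    ext τ
    have hj := UpperHalfPlane.denom_ne_zero γ τ
    have hj2 : denom γ τ ^ (-2 : ℤ) ≠ 0 := zpow_ne_zero _ hj
    have hj3 : (denom γ τ ^ (-2 : ℤ))⁻¹ = denom γ τ ^ 2 := by
      rw [zpow_neg, inv_inv]; rfl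
    rw [ModularForm.SL_slash_apply, zpow_neg, ← div_eq_mul_inv,
      div_eq_iff (zpow_ne_zero _ hj)]
    rw [hh]
    simp only
    -- The shifts by `c j` from `E₂` and from the cocycle cancel. What remains is `exp (-j² x L(1))
    -- j^(-2 L(0)) = j^(-2 L(0)) exp (-x L(1))`, whose coordinate of degree `n` carries `j^(-2n)`.
    rw [hs, cocycle, LinearMap.comp_apply, map_smul, ← expLone_add, frakC_mul_E2_smul,
      show -(-((γ 1 0 : ℤ) : ℂ) * denom γ τ + denom γ τ ^ 2 * (frakC * EisensteinSeries.E2 τ)) +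
        -((γ 1 0 : ℤ) : ℂ) * denom γ τ =
          -(frakC * EisensteinSeries.E2 τ) * (denom γ τ ^ (-2 : ℤ))⁻¹ by rw [hj3]; ring,
      ← A.powLzero_expLone hj2, map_smul, gradedBasis_coord_powLzero, smul_eq_mul, ← mul_assoc,
      ← zpow_mul, ← zpow_add₀ hj, mul_comm]
    congr 2
    ring
  exact ⟨{ toFun := h
           slash_action_eq' := by
             rintro _ ⟨γ, rfl⟩
             exact hsl γ
           holo' := hmd
           bdd_at_cusps' := fun {c} hc => by
             rw [OnePoint.isBoundedAt_iff_forall_SL2Z hc]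
             intro γ _
             exact (congrArg IsBoundedAtImInfty (hsl γ)).mpr hbd }, fun τ => rfl⟩

theorem exists_P_eq {k : ℤ} {F : ℍ → V} (hF : F ∈ A.modularForms k) :
    ∃ x ∈ A.weightPart k, A.P x = F := by
  choose h hh using A.exists_coordForm hF
  obtain ⟨N, hN, -⟩ := hF
  obtain ⟨S, hS⟩ := A.exists_finset_gradedBasis_repr N
  refine ⟨∑ j ∈ S, DirectSum.of (fun k : ℤ => ModularForm 𝒮ℒ k) (k - 2 * j.1) (h j) ⊗ₜ[ℂ]
    A.gradedBasis j, Submodule.sum_mem _ fun j _ => Submodule.subset_span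
      ⟨_, j.1, h j, A.gradedBasis j, by ring, A.gradedBasis_mem j, rfl⟩, ?_⟩
  ext τ
  rw [map_sum, Finset.sum_apply]
  simp only [P_of_tmul_apply, hh]
  simp only [← map_smul]
  rw [← map_sum, ← hS _ (A.expLone_mem_filt _ (hN τ)), expLone_expLone_neg]

theorem bijOn_P (k : ℤ) : Set.BijOn A.P (A.weightPart k) (A.modularForms k) := by
  refine ⟨fun x hx => A.P_mem_modularForms hx, fun x hx y hy hxy => ?_, fun F hF => ?_⟩
  · exact sub_eq_zero.1 (A.eq_zero_of_P_eq_zero (sub_mem hx hy) (by rw [map_sub, hxy, sub_self]))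
  · obtain ⟨x, hx, h⟩ := A.exists_P_eq hF
    exact ⟨x, hx, h⟩

end QuasiVOA

/-! ## The modular derivative on `M ⊗ V` -/

/-- Linear functionals separate points of `V`, so the chosen derivative vector is unique. -/
theorem vectorDeriv_eq {V : Type*} [AddCommGroup V] [Module ℂ V] {f : ℍ → V} {τ : ℍ} {w : V}
    (h : ∀ φ : Module.Dual ℂ V, HasDerivAt (fun z : ℂ => φ (f (ofComplex z))) (φ w) τ) :
    vectorDeriv f τ = w := by
  have hex : ∃ w : V, ∀ φ : Module.Dual ℂ V,
      HasDerivAt (fun z : ℂ => φ (f (ofComplex z))) (φ w) τ := ⟨w, h⟩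
  rw [vectorDeriv, dif_pos hex]
  refine sub_eq_zero.1 ((Module.forall_dual_apply_eq_zero_iff ℂ _).1 fun φ => ?_)
  rw [map_sub, (hex.choose_spec φ).unique (h φ), sub_self]

theorem hasDerivAt_comp_ofComplex {f : ℍ → ℂ} (hf : MDiff f) (τ : ℍ) :
    HasDerivAt (fun z => f (ofComplex z))
      (2 * Real.pi * I * Derivative.normalizedDerivOfComplex f τ) τ := by
  have h := (UpperHalfPlane.mdifferentiableAt_iff.1 (hf τ)).hasDerivAt
  rw [Derivative.normalizedDerivOfComplex, ← mul_assoc, mul_inv_cancel₀ two_pi_I_ne_zero, one_mul]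
  exact h

theorem LevelOneForms.serreD_of {r : ℤ} (f : ModularForm 𝒮ℒ r) :
    LevelOneForms.serreD (DirectSum.of (fun k : ℤ => ModularForm 𝒮ℒ k) r f) =
      DirectSum.of (fun k : ℤ => ModularForm 𝒮ℒ k) (r + 2) (serreDerivLevelOne r f) :=
  DirectSum.toModule_lof ℂ r f

theorem LevelOneForms.mulE4_of {r : ℤ} (f : ModularForm 𝒮ℒ r) :
    LevelOneForms.mulE4 (DirectSum.of (fun k : ℤ => ModularForm 𝒮ℒ k) r f) =
      DirectSum.of (fun k : ℤ => ModularForm 𝒮ℒ k) (4 + r) (ModularForm.E₄.mul f) := by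
  rw [mulE4, LinearMap.mulLeft_apply, DirectSum.of_mul_of]
  rfl

namespace QuasiVOA

variable {V : Type*} [AddCommGroup V] [Module ℂ V] (A : QuasiVOA V)

theorem nablaPrime_of_tmul {r : ℤ} (f : ModularForm 𝒮ℒ r) (v : V) :
    A.nablaPrime (DirectSum.of (fun k : ℤ => ModularForm 𝒮ℒ k) r f ⊗ₜ[ℂ] v) =
      (2 * Real.pi * I : ℂ) •
        (DirectSum.of (fun k : ℤ => ModularForm 𝒮ℒ k) (r + 2) (serreDerivLevelOne r f) ⊗ₜ[ℂ] v -
        frakC • (1 / 12 : ℂ) • (DirectSum.of (fun k : ℤ => ModularForm 𝒮ℒ k) (4 + r)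
          (ModularForm.E₄.mul f) ⊗ₜ[ℂ] A.Lone v)) +
      DirectSum.of (fun k : ℤ => ModularForm 𝒮ℒ k) r f ⊗ₜ[ℂ] A.Lneg v := by
  rw [nablaPrime, LinearMap.add_apply, LinearMap.smul_apply, LinearMap.sub_apply,
    LinearMap.smul_apply, TensorProduct.map_tmul, TensorProduct.map_tmul, TensorProduct.map_tmul,
    LinearMap.smul_apply, LevelOneForms.serreD_of, LevelOneForms.mulE4_of,
    ← TensorProduct.smul_tmul']
  rfl

theorem of_tmul_mem_weightPart {k r n : ℤ} (h : r + 2 * n = k) (f : ModularForm 𝒮ℒ r) {v : V}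
    (hv : v ∈ A.deg n) :
    DirectSum.of (fun k : ℤ => ModularForm 𝒮ℒ k) r f ⊗ₜ[ℂ] v ∈ A.weightPart k :=
  Submodule.subset_span ⟨r, n, f, v, h, hv, rfl⟩

theorem nablaPrime_mem_weightPart {k : ℤ} {x : LevelOneForms ⊗[ℂ] V} (hx : x ∈ A.weightPart k) :
    A.nablaPrime x ∈ A.weightPart (k + 2) := by
  induction hx using Submodule.span_induction with
  | mem x hx =>
    obtain ⟨r, n, f, v, rfl, hv, rfl⟩ := hx
    rw [nablaPrime_of_tmul]
    refine add_mem (Submodule.smul_mem _ _ (sub_mem ?_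
      (Submodule.smul_mem _ _ (Submodule.smul_mem _ _ ?_)))) ?_
    · exact A.of_tmul_mem_weightPart (by ring) _ hv
    · exact A.of_tmul_mem_weightPart (by ring) _ (A.Lone_mem hv)
    · exact A.of_tmul_mem_weightPart (by ring) _ (A.Lneg_mem hv)
  | zero => simp
  | add x y _ _ hx hy => rw [map_add]; exact add_mem hx hy
  | smul c x _ hx => rw [map_smul]; exact Submodule.smul_mem _ c hx

/-- The heart of the formula: the product rule, Ramanujan's identity and `expLone_Lneg` with `x = 𝔠
E₂`. The identity is solved for the derivative, so that both sides are linear in the tensor and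
extend to its span. -/
theorem hasDerivAt_P_of_tmul {r n : ℤ} (f : ModularForm 𝒮ℒ r) {v : V} (hv : v ∈ A.deg n)
    (φ : Module.Dual ℂ V) (τ : ℍ) :
    HasDerivAt (fun z : ℂ =>
        φ (A.P (DirectSum.of (fun k : ℤ => ModularForm 𝒮ℒ k) r f ⊗ₜ[ℂ] v) (ofComplex z)))
      (φ (A.P (A.nablaPrime (DirectSum.of (fun k : ℤ => ModularForm 𝒮ℒ k) r f ⊗ₜ[ℂ] v)) τ -
        A.Lneg (A.P (DirectSum.of (fun k : ℤ => ModularForm 𝒮ℒ k) r f ⊗ₜ[ℂ] v) τ) +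
        (2 * Real.pi * I * (r + 2 * n) / 12 * EisensteinSeries.E2 τ) •
          A.P (DirectSum.of (fun k : ℤ => ModularForm 𝒮ℒ k) r f ⊗ₜ[ℂ] v) τ)) τ := by
  have hE := ((hasDerivAt_comp_ofComplex E2_mdifferentiable τ).const_mul frakC)
  rw [normalizedDeriv_E2] at hE
  have hf := hasDerivAt_comp_ofComplex f.holo' τ
  have h := hf.mul (A.hasDerivAt_expLone hE v φ)
  have hserre : serreDerivLevelOne r f τ = Derivative.normalizedDerivOfComplex f τ -
      r * 12⁻¹ * EisensteinSeries.E2 τ * f τ := rfl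
  have hE4 : (ModularForm.E₄.mul f) τ = ModularForm.E₄ τ * f τ := rfl
  convert! h using 1
  · ext z
    rw [P_of_tmul_apply, map_smul, smul_eq_mul]
    rfl
  · rw [nablaPrime_of_tmul]
    simp only [map_add, map_sub, map_smul, Pi.add_apply, Pi.sub_apply, Pi.smul_apply,
      P_of_tmul_apply, A.expLone_Lneg _ hv, expLone_Lone, smul_eq_mul, hserre, hE4,
      ofComplex_apply]
    change _ = 2 * Real.pi * I * Derivative.normalizedDerivOfComplex f τ * _ + f τ * _
    -- The explicit constant is needed here: `2πi 𝔠 / 12 = -𝔠²` cancels the `E₂²` terms, and `2 n 𝔠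
    -- = -2πi (2 n) / 12` supplies the missing part of the weight.
    rw [frakC]
    ring

theorem hasDerivAt_P {k : ℤ} {x : LevelOneForms ⊗[ℂ] V} (hx : x ∈ A.weightPart k)
    (φ : Module.Dual ℂ V) (τ : ℍ) :
    HasDerivAt (fun z : ℂ => φ (A.P x (ofComplex z)))
      (φ (A.P (A.nablaPrime x) τ - A.Lneg (A.P x τ) +
        (2 * Real.pi * I * k / 12 * EisensteinSeries.E2 τ) • A.P x τ)) τ := by
  induction hx using Submodule.span_induction with
  | mem x hx =>
    obtain ⟨r, n, f, v, rfl, hv, rfl⟩ := hx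
    simpa using A.hasDerivAt_P_of_tmul f hv φ τ
  | zero => simpa using hasDerivAt_const (τ : ℂ) (0 : ℂ)
  | add x y _ _ hx hy =>
    convert! hx.add hy using 1
    · ext z
      simp
    · simp only [map_add, map_sub, Pi.add_apply, smul_add]
      abel
  | smul c x _ hx =>
    convert! hx.const_mul c using 1
    · ext z
      simp
    · simp only [map_add, map_sub, map_smul, Pi.smul_apply, smul_eq_mul]
      ring

theorem P_nablaPrime {k : ℤ} {x : LevelOneForms ⊗[ℂ] V} (hx : x ∈ A.weightPart k) :
    A.P (A.nablaPrime x) = A.nabla k (A.P x) := by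
  ext τ
  rw [nabla, vectorDeriv_eq fun φ => A.hasDerivAt_P hx φ τ]
  abel

theorem hom_ext_weightPart {W : Type*} [AddCommGroup W] [Module ℂ W]
    {S T : LevelOneForms ⊗[ℂ] V →ₗ[ℂ] W} (h : ∀ k, ∀ x ∈ A.weightPart k, S x = T x) : S = T := by
  refine TensorProduct.ext' fun f v => ?_
  induction f using DirectSum.induction_on with
  | zero => simp
  | of r f =>
    have h' : S ∘ₗ TensorProduct.mk ℂ LevelOneForms V (DirectSum.of _ r f) =
        T ∘ₗ TensorProduct.mk ℂ LevelOneForms V (DirectSum.of _ r f) :=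
      A.hom_ext_deg fun n v hv => h _ _ (A.of_tmul_mem_weightPart rfl f hv)
    exact LinearMap.congr_fun h' v
  | add f g hf hg => rw [TensorProduct.add_tmul, map_add, map_add, hf, hg]

end QuasiVOA

theorem mainTheorem12 {V : Type*} [AddCommGroup V] [Module ℂ V] (A : QuasiVOA V) :
    (∀ k : ℤ, Set.BijOn A.P (A.weightPart k) (A.modularForms k)) ∧
    (∀ k : ℤ, Set.MapsTo (A.nabla k) (A.modularForms k) (A.modularForms (k + 2))) ∧
    ∀ T : Module.End ℂ (LevelOneForms ⊗[ℂ] V),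
      (∀ (k : ℤ), ∀ x ∈ A.weightPart k,
        T x ∈ A.weightPart (k + 2) ∧ A.P (T x) = A.nabla k (A.P x)) ↔
      T = A.nablaPrime := by
  refine ⟨A.bijOn_P, fun k F hF => ?_, fun T => ⟨fun hT => ?_, ?_⟩⟩
  -- Modularity of `∇ F` needs no transformation formula for derivatives: surjectivity of `P` makes
  -- it `P (∇' x)`.
  · obtain ⟨x, hx, rfl⟩ := A.exists_P_eq hF
    rw [← A.P_nablaPrime hx]
    exact A.P_mem_modularForms (A.nablaPrime_mem_weightPart hx)
  -- The weight parts span `M ⊗ V`, and on each of them injectivity of `P` in weight `k + 2`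
  -- determines the value of `T`.
  · refine A.hom_ext_weightPart fun k x hx => ?_
    refine (A.bijOn_P (k + 2)).injOn (hT k x hx).1 (A.nablaPrime_mem_weightPart hx) ?_
    rw [(hT k x hx).2, A.P_nablaPrime hx]
  · rintro rfl k x hx
    exact ⟨A.nablaPrime_mem_weightPart hx, A.P_nablaPrime hx⟩
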